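/- Let $N\in\mathbb N=\{0,1,2,\dots\}$. Let $X=\{1,-1\}^N$ be the vertex set of the $N$-cube $H(N,2)$, in which two vertices are adjacent whenever they differ in exactly one coordinate. Let $\partial$ denote the path-length distance, let $G$ be the automorphism group of $H(N,2)$, let $V$ be the complex vector space with basis $X$, and let $\langle\,,\,\rangle$ be the Hermitian form on $V$ (linear in the first argument) for which $X$ is orthonormal. Fix $\varkappa\in X$. Define maps in $\mathrm{End}(V)$ as follows, for $\xi\in X$ and $0\le i\le N$. - $\mathsf A\,\xi=\sum_{\eta\in X,\ \partial(\xi,\eta)=1}\eta$ and $\mathsf A_i\,\xi=\sum_{\eta\in X,\ \partial(\xi,\eta)=i}\eta$. - $\mathsf E_i$ is the primitive idempotent of the diagonalizable map $\mathsf A$ for the eigenvalue $N-2i$: it is the identity on this eigenspace and zero on every other eigenspace of $\mathsf A$. - $\mathsf A^*\xi=(N-2\,\partial(\xi,\varkappa))\,\xi$. - $\mathsf E^*_i\,\xi=\xi$ if $\partial(\xi,\varkappa)=i$, and $\mathsf E^*_i\,\xi=0$ otherwise. - $\mathsf A^*_i\,\xi=2^N\langle \mathsf E_i\varkappa,\xi\rangle\,\xi$.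 Let $T$ be the subalgebra of $\mathrm{End}(V)$ generated by $\mathsf A$ and $\mathsf A^*$. Let $P_N$ be the space of homogeneous polynomials of degree $N$ in $\mathbb C[x,y,z,w]$, and put $$x^*=\tfrac{x+y+z+w}{2},\quad y^*=\tfrac{x+y-z-w}{2},\quad z^*=\tfrac{x-y+z-w}{2},\quad w^*=\tfrac{x-y-z+w}{2}.$$ The group $G$ acts diagonally on $V^{\otimes3}$; let $\mathrm{Fix}(G)\subseteq V^{\otimes 3}$ be the subspace of vectors fixed by every element of $G$. For natural numbers $r,s,t,u$ with $r+s+t+u=N$ let $B(r,s,t,u)\in\mathrm{Fix}(G)$ be the sum of all $a\otimes b\otimes c$ with $a,b,c\in X$ such that there are exactly $r$ coordinates $k$ with $a_k=b_k=c_k$, exactly $s$ with $a_k\ne b_k=c_k$, exactly $t$ with $b_k\neq c_k=a_k$, and exactly $u$ with $c_k\ne a_k=b_k$. Let $\ddag:P_N\to\mathrm{Fix}(G)$ be the $\mathbb C$-linear map with $$x^ry^sz^tw^u\mapsto (N!\,2^N)^{1/2}\,\frac{r!\,s!\,t!\,u!}{N!\,2^N}\,B(r,s,t,u)\qquad (r+s+t+u=N).$$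 Let $\varepsilon:V^{\otimes3}\to\mathrm{End}(V)$ be the $\mathbb C$-linear map such that, for $a,b,c\in X$, $\varepsilon(a\otimes b\otimes c)=2^{N/2}e_{b,c}$ if $a=\varkappa$ and $\varepsilon(a\otimes b\otimes c)=0$ otherwise, where $e_{b,c}\in\mathrm{End}(V)$ sends $c\mapsto b$ and all other vertices to $0$. The composition $\varepsilon\circ\ddag$ takes values in $T$; let $\vartheta:P_N\to T$ denote this composition. **Theorem.** For all natural numbers $r,s,t,u$ with $r+s+t+u=N$, the map $\vartheta$ sends $$x^ry^sz^tw^u\mapsto\frac{r!\,s!\,t!\,u!}{(N!)^{1/2}}\;\mathsf E^*_j\,\mathsf A_h\,\mathsf E^*_i,\qquad x^{*r}y^{*s}z^{*t}w^{*u}\mapsto\frac{r!\,s!\,t!\,u!}{(N!)^{1/2}}\;\mathsf E_i\,\mathsf A^*_h\,\mathsf E_j,$$ where $h=t+u$, $i=u+s$, $j=s+t$. -/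

import Mathlib

/-- The vertex set of the `N`-cube: `N`-tuples with entries in `{1, -1}` (the units of `ℤ`). -/
abbrev Vertex (N : ℕ) : Type := Fin N → ℤˣ

/-- The `N`-cube: two vertices are adjacent iff they differ in exactly one coordinate. -/
def hypercube (N : ℕ) : SimpleGraph (Vertex N) where
  Adj x y := hammingDist x y = 1
  symm := ⟨fun x y h => by rw [hammingDist_comm]; exact h⟩
  loopless := ⟨fun x h => by simp at h⟩

instance (N : ℕ) : DecidableRel (hypercube N).Adj :=
  fun x y => inferInstanceAs (Decidable (hammingDist x y = 1))

/-- The path-length distance in the `N`-cube. -/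
noncomputable def cubeDist {N : ℕ} (x y : Vertex N) : ℕ := (hypercube N).dist x y

/-- The standard module: the complex vector space with basis the vertex set, with the Hermitian
form for which this basis is orthonormal. -/
abbrev StdModule (N : ℕ) : Type := EuclideanSpace ℂ (Vertex N)

/-- The basis of the standard module formed by the vertices. -/
noncomputable def vtx (N : ℕ) : Module.Basis (Vertex N) ℂ (StdModule N) :=
  (EuclideanSpace.basisFun (Vertex N) ℂ).toBasis

/-- The Hermitian form, linear in the first argument and conjugate-linear in the second one
(Mathlib's `inner` has the opposite convention). -/
noncomputable def herm {N : ℕ} (u v : StdModule N) : ℂ := inner ℂ v u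

/-- The adjacency map. -/
noncomputable def adjMap (N : ℕ) : Module.End ℂ (StdModule N) :=
  (vtx N).constr ℂ fun x => ∑ ξ with (hypercube N).Adj x ξ, vtx N ξ

/-- The `i`-th distance map `A_i`. -/
noncomputable def distMap (N i : ℕ) : Module.End ℂ (StdModule N) :=
  (vtx N).constr ℂ fun x => ∑ ξ with cubeDist x ξ = i, vtx N ξ

/-- The scalar `θ_i = θ*_i = N - 2 i`. -/
def theta (N i : ℕ) : ℂ := (N : ℂ) - 2 * (i : ℂ)

/-- The dual adjacency map with respect to the vertex `κ`. -/
noncomputable def dualAdjMap {N : ℕ} (κ : Vertex N) : Module.End ℂ (StdModule N) :=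
  (vtx N).constr ℂ fun x => theta N (cubeDist x κ) • vtx N x

/-- The `i`-th dual primitive idempotent `E*_i` with respect to `κ`. -/
noncomputable def dualIdem {N : ℕ} (κ : Vertex N) (i : ℕ) : Module.End ℂ (StdModule N) :=
  (vtx N).constr ℂ fun x => if cubeDist x κ = i then vtx N x else 0

/-- The subconstituent (Terwilliger) algebra with respect to `κ`: the subalgebra of `End V`
generated by the adjacency map and the dual adjacency map. -/
noncomputable def subconstituentAlg {N : ℕ} (κ : Vertex N) :
    Subalgebra ℂ (Module.End ℂ (StdModule N)) :=
  Algebra.adjoin ℂ {adjMap N, dualAdjMap κ}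

/-! ### Primitive idempotents of a diagonalizable map -/

theorem isCompl_eigenspace {W : Type*} [AddCommGroup W] [Module ℂ W] (B : Module.End ℂ W)
    (hB : ⨆ μ, B.eigenspace μ = ⊤) (μ : ℂ) :
    IsCompl (B.eigenspace μ) (⨆ ν, ⨆ _ : ν ≠ μ, B.eigenspace ν) := by
  refine ⟨B.eigenspaces_iSupIndep μ, codisjoint_iff.mpr ?_⟩
  rw [eq_top_iff, ← hB]
  refine iSup_le fun ν => ?_
  by_cases h : ν = μ
  · subst h; exact le_sup_left
  · exact le_sup_of_le_right (le_iSup₂_of_le ν h le_rfl)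

/-- The primitive idempotent of a diagonalizable map `B` for the scalar `μ`: it is the identity on
the `μ`-eigenspace of `B` and zero on all other eigenspaces of `B`. -/
noncomputable def primitiveIdem {W : Type*} [AddCommGroup W] [Module ℂ W] (B : Module.End ℂ W)
    (hB : ⨆ μ, B.eigenspace μ = ⊤) (μ : ℂ) : Module.End ℂ W :=
  Submodule.projection _ _ (isCompl_eigenspace B hB μ)

theorem adjMap_vtx {N : ℕ} (x : Vertex N) :
    adjMap N (vtx N x) = ∑ ξ with (hypercube N).Adj x ξ, vtx N ξ := by
  simp [adjMap]

theorem inner_vtx {N : ℕ} (x y : Vertex N) :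
    inner ℂ (vtx N x) (vtx N y) = if x = y then (1 : ℂ) else 0 := by
  simp [vtx, EuclideanSpace.basisFun_apply, EuclideanSpace.inner_single_left]

theorem adjMap_isSymmetric (N : ℕ) : (adjMap N).IsSymmetric := by
  have key : ∀ x y : Vertex N, inner ℂ (adjMap N (vtx N x)) (vtx N y)
      = inner ℂ (vtx N x) (adjMap N (vtx N y)) := by
    intro x y
    simp only [adjMap_vtx, sum_inner, inner_sum, inner_vtx, Finset.sum_ite_eq',
      Finset.sum_ite_eq, Finset.mem_filter, Finset.mem_univ, true_and]
    simp [(hypercube N).adj_comm x y]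
  intro u v
  rw [← (vtx N).sum_repr u, ← (vtx N).sum_repr v]
  simp only [map_sum, map_smul, sum_inner, inner_sum, inner_smul_left, inner_smul_right, key]

theorem adjMap_diagonalizable (N : ℕ) : ⨆ μ, (adjMap N).eigenspace μ = ⊤ :=
  Submodule.orthogonal_eq_bot_iff.mp
    (adjMap_isSymmetric N).orthogonalComplement_iSup_eigenspaces_eq_bot

/-- The primitive idempotent `E_i` of the adjacency map for the eigenvalue `θ_i`. -/
noncomputable def adjIdem (N i : ℕ) : Module.End ℂ (StdModule N) :=
  primitiveIdem (adjMap N) (adjMap_diagonalizable N) (theta N i)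

/-- The `i`-th dual distance map `A*_i` with respect to `κ`. -/
noncomputable def dualDistMap {N : ℕ} (κ : Vertex N) (i : ℕ) : Module.End ℂ (StdModule N) :=
  (vtx N).constr ℂ fun x => ((2 : ℂ) ^ N * herm (adjIdem N i (vtx N κ)) (vtx N x)) • vtx N x

/-! ### The third tensor power of the standard module -/

/-- The space `V ⊗ V ⊗ V`. -/
abbrev StdModule3 (N : ℕ) : Type :=
  TensorProduct ℂ (StdModule N) (TensorProduct ℂ (StdModule N) (StdModule N))

/-- The basis `x ⊗ y ⊗ z` of `V ⊗ V ⊗ V`. -/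
noncomputable def vtx3 (N : ℕ) :
    Module.Basis (Vertex N × Vertex N × Vertex N) ℂ (StdModule3 N) :=
  (vtx N).tensorProduct ((vtx N).tensorProduct (vtx N))

/-- The action on `V` of an automorphism of the `N`-cube. -/
noncomputable def autAct {N : ℕ} (g : hypercube N ≃g hypercube N) : Module.End ℂ (StdModule N) :=
  (vtx N).constr ℂ fun x => vtx N (g x)

/-- The diagonal action on `V ⊗ V ⊗ V` of an automorphism of the `N`-cube. -/
noncomputable def autAct3 {N : ℕ} (g : hypercube N ≃g hypercube N) :
    Module.End ℂ (StdModule3 N) :=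
  TensorProduct.map (autAct g) (TensorProduct.map (autAct g) (autAct g))

/-- The subspace `Fix(G)` of `V ⊗ V ⊗ V`, where `G` is the automorphism group of the `N`-cube. -/
def fixSpace (N : ℕ) : Submodule ℂ (StdModule3 N) where
  carrier := {v | ∀ g : hypercube N ≃g hypercube N, autAct3 g v = v}
  zero_mem' g := map_zero _
  add_mem' ha hb g := by rw [map_add, ha g, hb g]
  smul_mem' c _ ha g := by rw [map_smul, ha g]

/-- The profile `(r, s, t, u)` of a triple of vertices `(x, y, z)`. -/
def profile {N : ℕ} (p : Vertex N × Vertex N × Vertex N) : ℕ × ℕ × ℕ × ℕ :=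
  (Finset.card {k | p.1 k = p.2.1 k ∧ p.2.1 k = p.2.2 k},
   Finset.card {k | p.1 k ≠ p.2.1 k ∧ p.2.1 k = p.2.2 k},
   Finset.card {k | p.2.1 k ≠ p.2.2 k ∧ p.2.2 k = p.1 k},
   Finset.card {k | p.2.2 k ≠ p.1 k ∧ p.1 k = p.2.1 k})

/-- The vector `B(r, s, t, u)`: the sum of all `x ⊗ y ⊗ z` with profile `(r, s, t, u)`. -/
noncomputable def profileVec (N r s t u : ℕ) : StdModule3 N :=
  ∑ p : Vertex N × Vertex N × Vertex N with profile p = (r, s, t, u), vtx3 N p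

/-- The vector `B̃(r, s, t, u) = r! s! t! u! / (N! 2 ^ N) • B(r, s, t, u)`. -/
noncomputable def dualProfileVec (N r s t u : ℕ) : StdModule3 N :=
  ((r.factorial * s.factorial * t.factorial * u.factorial : ℂ) / (N.factorial * 2 ^ N)) •
    profileVec N r s t u

/-! ### Profiles and distances -/

theorem int_units_eq_neg_of_ne {a b : ℤˣ} (h : a ≠ b) : a = -b := by
  rcases Int.units_eq_one_or a with rfl | rfl <;> rcases Int.units_eq_one_or b with rfl | rfl <;>
    simp_all

/-- Change the sign of the `k`-th coordinate. -/
def flipAt {N : ℕ} (k : Fin N) (x : Vertex N) : Vertex N := Function.update x k (-x k)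

theorem flipAt_flipAt {N : ℕ} (k : Fin N) (x : Vertex N) : flipAt k (flipAt k x) = x := by
  funext l
  by_cases h : l = k
  · subst h; simp [flipAt]
  · simp [flipAt, h]

theorem hammingDist_flipAt_self {N : ℕ} (k : Fin N) (y : Vertex N) :
    hammingDist y (flipAt k y) = 1 := by
  have h : Finset.filter (fun l => y l ≠ flipAt k y l) Finset.univ = {k} := by
    ext l
    rw [Finset.mem_filter]
    by_cases h : l = k
    · subst h; simp [flipAt]
    · simp [flipAt, h]
  simp [hammingDist, h]

theorem hammingDist_flipAt_of_eq {N : ℕ} {k : Fin N} {x y : Vertex N} (hk : x k = y k) :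
    hammingDist x (flipAt k y) = hammingDist x y + 1 := by
  have h : Finset.filter (fun l => x l ≠ flipAt k y l) Finset.univ =
      insert k (Finset.filter (fun l => x l ≠ y l) Finset.univ) := by
    ext l
    rw [Finset.mem_insert, Finset.mem_filter, Finset.mem_filter]
    by_cases h : l = k
    · subst h; simp [flipAt, hk]
    · simp [flipAt, h]
  unfold hammingDist
  rw [h, Finset.card_insert_of_notMem (by simp [hk])]

theorem hammingDist_flipAt_of_ne {N : ℕ} {k : Fin N} {x y : Vertex N} (hk : x k ≠ y k) :
    hammingDist x (flipAt k y) + 1 = hammingDist x y := by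
  have h1 : x k = flipAt k y k := by simpa [flipAt] using int_units_eq_neg_of_ne hk
  have h2 := hammingDist_flipAt_of_eq h1
  rw [flipAt_flipAt] at h2
  exact h2.symm

theorem hypercube_adj_iff {N : ℕ} (x y : Vertex N) :
    (hypercube N).Adj x y ↔ ∃ k, flipAt k x = y := by
  constructor
  · intro h
    have h' : hammingDist x y = 1 := h
    obtain ⟨k, hk⟩ := Finset.card_eq_one.mp h'
    refine ⟨k, funext fun l => ?_⟩
    have hl := Finset.ext_iff.mp hk l
    simp only [Finset.mem_filter, Finset.mem_univ, true_and, Finset.mem_singleton] at hl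
    by_cases hlk : l = k
    · subst hlk
      have := int_units_eq_neg_of_ne (hl.mpr rfl)
      simp [flipAt, this]
    · simpa [flipAt, hlk] using not_not.mp (mt hl.mp hlk)
  · rintro ⟨k, rfl⟩
    exact hammingDist_flipAt_self k x

theorem hammingDist_le_length {N : ℕ} {x y : Vertex N} (p : (hypercube N).Walk x y) :
    hammingDist x y ≤ p.length := by
  induction p with
  | nil => simp
  | @cons a b c h p ih =>
    have h1 : hammingDist a b = 1 := h
    have h2 := hammingDist_triangle a b c
    rw [SimpleGraph.Walk.length_cons]
    omega

theorem exists_walk_hammingDist {N : ℕ} (x y : Vertex N) :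
    ∃ p : (hypercube N).Walk x y, p.length = hammingDist x y := by
  induction hd : hammingDist x y generalizing y with
  | zero =>
    obtain rfl := eq_of_hammingDist_eq_zero hd
    exact ⟨.nil, rfl⟩
  | succ d ih =>
    have hne : x ≠ y := by rintro rfl; simp at hd
    obtain ⟨k, hk⟩ := Function.ne_iff.mp hne
    have h1 := hammingDist_flipAt_of_ne hk
    obtain ⟨p, hp⟩ := ih (flipAt k y) (by omega)
    have hadj : (hypercube N).Adj (flipAt k y) y :=
      ((hypercube_adj_iff y _).mpr ⟨k, rfl⟩).symm
    exact ⟨p.concat hadj, by rw [SimpleGraph.Walk.length_concat, hp]⟩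

theorem cubeDist_eq_hammingDist {N : ℕ} (x y : Vertex N) : cubeDist x y = hammingDist x y := by
  obtain ⟨p, hp⟩ := exists_walk_hammingDist x y
  refine le_antisymm (hp ▸ SimpleGraph.dist_le p) ?_
  obtain ⟨q, hq⟩ := (SimpleGraph.Walk.reachable p).exists_walk_length_eq_dist
  exact (hammingDist_le_length q).trans hq.le

theorem cubeDist_comm {N : ℕ} (x y : Vertex N) : cubeDist x y = cubeDist y x := by
  simp only [cubeDist_eq_hammingDist, hammingDist_comm]

theorem cubeDist_le {N : ℕ} (x y : Vertex N) : cubeDist x y ≤ N := by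
  rw [cubeDist_eq_hammingDist]
  simpa using hammingDist_le_card_fintype (x := x) (y := y)

theorem cubeDist_aut {N : ℕ} (g : hypercube N ≃g hypercube N) (x y : Vertex N) :
    cubeDist (g x) (g y) = cubeDist x y := by
  have key : ∀ (g : hypercube N ≃g hypercube N) (x y : Vertex N),
      cubeDist (g x) (g y) ≤ cubeDist x y := by
    intro g x y
    obtain ⟨p, hp⟩ := exists_walk_hammingDist x y
    rw [cubeDist_eq_hammingDist x y, ← hp, ← SimpleGraph.Walk.length_map g.toHom p]
    exact SimpleGraph.dist_le (p.map g.toHom)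
  refine le_antisymm (key g x y) ?_
  simpa using key g.symm (g x) (g y)

theorem profile_eq_iff {N : ℕ} (p : Vertex N × Vertex N × Vertex N) {r s t u : ℕ}
    (h : r + s + t + u = N) :
    profile p = (r, s, t, u) ↔
      cubeDist p.1 p.2.1 = s + t ∧ cubeDist p.2.1 p.2.2 = t + u ∧ cubeDist p.2.2 p.1 = u + s := by
  obtain ⟨x, y, z⟩ := p
  have tri : ∀ a b c : ℤˣ, a ≠ b → c ≠ b → a = c := fun a b c hab hcb =>
    (int_units_eq_neg_of_ne hab).trans (int_units_eq_neg_of_ne hcb).symm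
  have split : ∀ (P Q R : Fin N → Prop) [DecidablePred P] [DecidablePred Q] [DecidablePred R],
      (∀ k, P k ↔ Q k ∨ R k) → (∀ k, ¬(Q k ∧ R k)) →
      Finset.card {k | P k} = Finset.card {k | Q k} + Finset.card {k | R k} := by
    intro P Q R _ _ _ h1 h2
    rw [← Finset.card_union_of_disjoint, ← Finset.filter_or]
    · congr 1; ext k; simp [h1]
    · exact Finset.disjoint_filter.mpr fun k _ hq hr => h2 k ⟨hq, hr⟩
  have hxy : cubeDist x y = Finset.card {k | x k ≠ y k ∧ y k = z k} +
      Finset.card {k | y k ≠ z k ∧ z k = x k} := by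
    rw [cubeDist_eq_hammingDist]
    refine split _ _ _ (fun k => ?_) fun k => ?_
    · have := tri (x k) (y k) (z k); grind
    · grind
  have hyz : cubeDist y z = Finset.card {k | y k ≠ z k ∧ z k = x k} +
      Finset.card {k | z k ≠ x k ∧ x k = y k} := by
    rw [cubeDist_eq_hammingDist]
    refine split _ _ _ (fun k => ?_) fun k => ?_
    · have := tri (y k) (z k) (x k); grind
    · grind
  have hzx : cubeDist z x = Finset.card {k | z k ≠ x k ∧ x k = y k} +
      Finset.card {k | x k ≠ y k ∧ y k = z k} := by
    rw [cubeDist_eq_hammingDist]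
    refine split _ _ _ (fun k => ?_) fun k => ?_
    · have := tri (z k) (x k) (y k); grind
    · grind
  have htot : N = Finset.card {k | x k = y k ∧ y k = z k} +
      Finset.card {k | ¬(x k = y k ∧ y k = z k)} := by
    rw [Finset.card_filter_add_card_filter_not]; simp
  have hrest : Finset.card {k | ¬(x k = y k ∧ y k = z k)} =
      Finset.card {k | x k ≠ y k} + Finset.card {k | z k ≠ x k ∧ x k = y k} :=
    split _ _ _ (fun k => by grind) fun k => by grind
  have hxy' : cubeDist x y = Finset.card {k | x k ≠ y k} := cubeDist_eq_hammingDist x y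
  simp only [profile, Prod.mk.injEq]
  omega

theorem profile_aut {N : ℕ} (g : hypercube N ≃g hypercube N) (p : Vertex N × Vertex N × Vertex N)
    {r s t u : ℕ} (h : r + s + t + u = N) :
    profile (g p.1, g p.2.1, g p.2.2) = (r, s, t, u) ↔ profile p = (r, s, t, u) := by
  simp only [profile_eq_iff _ h, cubeDist_aut]

theorem autAct3_vtx3 {N : ℕ} (g : hypercube N ≃g hypercube N)
    (p : Vertex N × Vertex N × Vertex N) :
    autAct3 g (vtx3 N p) = vtx3 N (g p.1, g p.2.1, g p.2.2) := by
  simp [autAct3, vtx3, autAct, Module.Basis.tensorProduct_apply']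

theorem profileVec_mem_fixSpace {N r s t u : ℕ} (h : r + s + t + u = N) :
    profileVec N r s t u ∈ fixSpace N := by
  intro g
  simp only [profileVec, map_sum, autAct3_vtx3]
  refine Finset.sum_equiv
    (g.toEquiv.prodCongr (g.toEquiv.prodCongr g.toEquiv)) (fun p => ?_) fun p _ => rfl
  simp only [Finset.mem_filter, Finset.mem_univ, true_and]
  exact (profile_aut g p h).symm

/-! ### The map `‡` -/

/-- The space `P_N` of homogeneous polynomials of degree `N` in `x, y, z, w`
(the variables `X 0, X 1, X 2, X 3`). -/
abbrev homPoly (N : ℕ) : Submodule ℂ (MvPolynomial (Fin 4) ℂ) :=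
  MvPolynomial.homogeneousSubmodule (Fin 4) ℂ N

/-- The linear map on polynomials that sends every monomial `x ^ r y ^ s z ^ t w ^ u` to
`(N! 2 ^ N) ^ (1 / 2) • B̃(r, s, t, u)`; only its restriction to `P_N` is used. -/
noncomputable def ddagPoly (N : ℕ) : MvPolynomial (Fin 4) ℂ →ₗ[ℂ] StdModule3 N :=
  (MvPolynomial.basisMonomials (Fin 4) ℂ).constr ℂ fun m =>
    ((Real.sqrt (N.factorial * 2 ^ N) : ℝ) : ℂ) • dualProfileVec N (m 0) (m 1) (m 2) (m 3)

theorem ddagPoly_mem_of_monomials {N : ℕ} (S : Submodule ℂ (StdModule3 N))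
    (hS : ∀ r s t u, r + s + t + u = N → profileVec N r s t u ∈ S)
    {f : MvPolynomial (Fin 4) ℂ} (hf : f ∈ homPoly N) : ddagPoly N f ∈ S := by
  rw [f.as_sum, map_sum]
  refine S.sum_mem fun m hm => ?_
  have hdeg : m.degree = N := by
    have h1 := (MvPolynomial.mem_homogeneousSubmodule N f).mp hf
      (MvPolynomial.mem_support_iff.mp hm)
    rw [Finsupp.degree_eq_weight_one]
    exact h1
  have h2 : MvPolynomial.monomial m (f.coeff m) =
      f.coeff m • MvPolynomial.basisMonomials (Fin 4) ℂ m := by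
    simp [MvPolynomial.smul_monomial]
  rw [h2, map_smul, ddagPoly, Module.Basis.constr_basis]
  refine S.smul_mem _ (S.smul_mem _ (S.smul_mem _ (hS _ _ _ _ ?_)))
  rw [← hdeg, Finsupp.degree_eq_sum, Fin.sum_univ_four]

/-- The linear map `‡ : P_N → Fix(G)` that sends
`x ^ r y ^ s z ^ t w ^ u` to `(N! 2 ^ N) ^ (1 / 2) • B̃(r, s, t, u)` for `r + s + t + u = N`. -/
noncomputable def ddag (N : ℕ) : homPoly N →ₗ[ℂ] fixSpace N :=
  ((ddagPoly N).domRestrict (homPoly N)).codRestrict (fixSpace N) fun f =>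
    ddagPoly_mem_of_monomials _ (fun _ _ _ _ h => profileVec_mem_fixSpace h) f.2

/-! ### The map `ε` -/

/-- The map `e_{x,y}` that sends `y` to `x` and all other vertices to `0`. -/
noncomputable def elemMap {N : ℕ} (x y : Vertex N) : Module.End ℂ (StdModule N) :=
  (vtx N).constr ℂ fun v => if v = y then vtx N x else 0

/-- The linear map `ε : V ⊗ V ⊗ V → End V` that sends `x ⊗ y ⊗ z` to `2 ^ (N / 2) • e_{y,z}` if
`x = κ`, and to `0` if `x ≠ κ`. -/
noncomputable def epsilonMap {N : ℕ} (κ : Vertex N) :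
    StdModule3 N →ₗ[ℂ] Module.End ℂ (StdModule N) :=
  (vtx3 N).constr ℂ fun p =>
    if p.1 = κ then ((Real.sqrt (2 ^ N) : ℝ) : ℂ) • elemMap p.2.1 p.2.2 else 0

theorem distMap_vtx {N : ℕ} (i : ℕ) (x : Vertex N) :
    distMap N i (vtx N x) = ∑ ξ with cubeDist x ξ = i, vtx N ξ := by
  simp [distMap]

theorem adjMap_vtx_eq_sum_flipAt {N : ℕ} (x : Vertex N) :
    adjMap N (vtx N x) = ∑ k, vtx N (flipAt k x) := by
  have hinj : Function.Injective fun k : Fin N => flipAt k x := by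
    intro k l h
    by_contra hkl
    have := congrFun h k
    simp [flipAt, hkl, eq_comm] at this
  rw [adjMap_vtx, ← Finset.sum_image (f := fun ξ => vtx N ξ) (s := Finset.univ)
    (g := fun k => flipAt k x) hinj.injOn]
  refine Finset.sum_congr ?_ fun _ _ => rfl
  ext ξ
  simp [hypercube_adj_iff]

theorem repr_sum_vtx {N : ℕ} (i : ℕ) (x y : Vertex N) :
    (vtx N).repr (distMap N i (vtx N x)) y = if cubeDist x y = i then 1 else 0 := by
  simp [distMap_vtx, Finsupp.single_apply, Finset.sum_ite_eq']

theorem adjMap_mul_distMap (N h : ℕ) :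
    adjMap N * distMap N (h + 1) =
      ((h + 2 : ℕ) : ℂ) • distMap N (h + 2) + ((N - h : ℕ) : ℂ) • distMap N h := by
  refine (vtx N).ext fun x => (vtx N).repr.injective (Finsupp.ext fun y => ?_)
  have h1 : (vtx N).repr ((adjMap N * distMap N (h + 1)) (vtx N x)) y =
      ∑ k, if cubeDist x (flipAt k y) = h + 1 then (1 : ℂ) else 0 := by
    rw [Module.End.mul_apply, distMap_vtx]
    simp only [map_sum, adjMap_vtx_eq_sum_flipAt, Module.Basis.repr_self, Finsupp.coe_finsetSum,
      Finset.sum_apply]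
    rw [Finset.sum_comm]
    refine Finset.sum_congr rfl fun k _ => ?_
    have h2 : ∀ ξ : Vertex N, flipAt k ξ = y ↔ ξ = flipAt k y := fun ξ =>
      ⟨fun e => by rw [← e, flipAt_flipAt], fun e => by rw [e, flipAt_flipAt]⟩
    simp [Finsupp.single_apply, h2, Finset.sum_ite_eq']
  have h3 : ∀ k, (if cubeDist x (flipAt k y) = h + 1 then (1 : ℂ) else 0) =
      if x k ≠ y k then (if cubeDist x y = h + 2 then 1 else 0)
      else (if cubeDist x y = h then 1 else 0) := by
    intro k
    simp only [cubeDist_eq_hammingDist]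
    split_ifs with ha hb hc hc hb hc hc
    all_goals first
      | rfl
      | (exfalso
         first
          | (have := hammingDist_flipAt_of_ne hb; omega)
          | (have := hammingDist_flipAt_of_eq (not_not.mp hb); omega))
  rw [h1, Finset.sum_congr rfl fun k _ => h3 k, Finset.sum_ite]
  have h4 : Finset.card {k | x k ≠ y k} = cubeDist x y := (cubeDist_eq_hammingDist x y).symm
  have h5 : Finset.card {k | ¬ x k ≠ y k} = N - cubeDist x y := by
    have := Finset.card_filter_add_card_filter_not (s := (Finset.univ : Finset (Fin N)))
      (fun k => x k ≠ y k)
    simp only [Finset.card_univ, Fintype.card_fin] at this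
    omega
  simp only [Finset.sum_const, h4, h5, LinearMap.add_apply, LinearMap.smul_apply, map_add,
    map_smul, Finsupp.add_apply, Finsupp.smul_apply, repr_sum_vtx]
  split_ifs <;> simp_all

theorem distMap_mem_subconstituentAlg {N : ℕ} (κ : Vertex N) (h : ℕ) :
    distMap N h ∈ subconstituentAlg κ := by
  have hA : adjMap N ∈ subconstituentAlg κ := Algebra.subset_adjoin (by simp)
  have h0 : distMap N 0 = 1 := by
    refine (vtx N).ext fun x => ?_
    simp [distMap_vtx, cubeDist_eq_hammingDist, Finset.filter_eq]
  have h1 : distMap N 1 = adjMap N := by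
    refine (vtx N).ext fun x => ?_
    rw [distMap_vtx, adjMap_vtx]
    simp only [cubeDist_eq_hammingDist]
    rfl
  suffices H : distMap N h ∈ subconstituentAlg κ ∧ distMap N (h + 1) ∈ subconstituentAlg κ from H.1
  induction h with
  | zero => exact ⟨h0 ▸ one_mem _, by rw [zero_add, h1]; exact hA⟩
  | succ h ih =>
    refine ⟨ih.2, ?_⟩
    have hne : ((h + 2 : ℕ) : ℂ) ≠ 0 := Nat.cast_ne_zero.mpr (by omega)
    have e : distMap N (h + 1 + 1) = ((h + 2 : ℕ) : ℂ)⁻¹ •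
        (adjMap N * distMap N (h + 1) - ((N - h : ℕ) : ℂ) • distMap N h) := by
      rw [adjMap_mul_distMap, add_sub_cancel_right, smul_smul, inv_mul_cancel₀ hne, one_smul]
    rw [e]
    exact Subalgebra.smul_mem _ (sub_mem (mul_mem hA ih.2) (Subalgebra.smul_mem _ ih.1 _)) _

theorem dualIdem_vtx {N : ℕ} (κ : Vertex N) (i : ℕ) (x : Vertex N) :
    dualIdem κ i (vtx N x) = if cubeDist x κ = i then vtx N x else 0 := by
  rw [dualIdem, Module.Basis.constr_basis]

theorem dualIdem_mem_subconstituentAlg {N : ℕ} (κ : Vertex N) {j : ℕ} (hj : j ≤ N) :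
    dualIdem κ j ∈ subconstituentAlg κ := by
  have hA : dualAdjMap κ ∈ subconstituentAlg κ := Algebra.subset_adjoin (by simp)
  have hinj : Set.InjOn (theta N) (Finset.range (N + 1)) := by
    intro a _ b _ hab
    simpa [theta] using hab
  have hj' : j ∈ Finset.range (N + 1) := by simpa [Nat.lt_succ_iff] using hj
  have e : dualIdem κ j =
      Polynomial.aeval (dualAdjMap κ) (Lagrange.basis (Finset.range (N + 1)) (theta N) j) := by
    refine (vtx N).ext fun x => ?_
    have hev : (dualAdjMap κ).HasEigenvector (theta N (cubeDist x κ)) (vtx N x) :=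
      ⟨Module.End.mem_eigenspace_iff.mpr (by simp [dualAdjMap]), (vtx N).ne_zero x⟩
    rw [Module.End.aeval_apply_of_hasEigenvector hev, dualIdem_vtx]
    have hx : cubeDist x κ ∈ Finset.range (N + 1) := by
      simpa [Nat.lt_succ_iff] using cubeDist_le x κ
    split_ifs with h
    · subst h
      rw [Lagrange.eval_basis_self hinj hj', one_smul]
    · rw [Lagrange.eval_basis_of_ne (Ne.symm h) hx, zero_smul]
  rw [e]
  exact Algebra.adjoin_mono (by simp) (Polynomial.aeval_mem_adjoin_singleton ℂ (dualAdjMap κ))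

theorem epsilonMap_profileVec {N : ℕ} (κ : Vertex N) {r s t u : ℕ} (h : r + s + t + u = N) :
    epsilonMap κ (profileVec N r s t u) = ((Real.sqrt (2 ^ N) : ℝ) : ℂ) •
      (dualIdem κ (s + t) * distMap N (t + u) * dualIdem κ (u + s)) := by
  refine (vtx N).ext fun ψ => ?_
  have hε : ∀ p : Vertex N × Vertex N × Vertex N, epsilonMap κ (vtx3 N p) (vtx N ψ) =
      if p.1 = κ then (if p.2.2 = ψ then ((Real.sqrt (2 ^ N) : ℝ) : ℂ) • vtx N p.2.1 else 0)
      else 0 := by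
    intro p
    rw [epsilonMap, Module.Basis.constr_basis]
    split_ifs with h1 h2
    · rw [LinearMap.smul_apply, elemMap, Module.Basis.constr_basis, if_pos h2.symm]
    · rw [LinearMap.smul_apply, elemMap, Module.Basis.constr_basis, if_neg (Ne.symm h2), smul_zero]
    · rfl
  have hL : epsilonMap κ (profileVec N r s t u) (vtx N ψ) =
      ∑ y, if profile (κ, y, ψ) = (r, s, t, u) then
        ((Real.sqrt (2 ^ N) : ℝ) : ℂ) • vtx N y else 0 := by
    rw [profileVec, map_sum, LinearMap.sum_apply, Finset.sum_filter, Fintype.sum_prod_type,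
      Fintype.sum_eq_single κ, Fintype.sum_prod_type]
    · refine Finset.sum_congr rfl fun y _ => ?_
      rw [Fintype.sum_eq_single ψ]
      · simp [hε]
      · intro z hz
        simp [hε, hz]
    · intro x hx
      simp [hε, hx]
  rw [hL, LinearMap.smul_apply, Module.End.mul_apply, Module.End.mul_apply, dualIdem_vtx]
  simp only [profile_eq_iff _ h]
  by_cases h1 : cubeDist ψ κ = u + s
  · rw [if_pos h1, distMap_vtx, map_sum, Finset.sum_filter, Finset.smul_sum]
    refine Finset.sum_congr rfl fun y _ => ?_
    rw [dualIdem_vtx, cubeDist_comm κ y, cubeDist_comm ψ y]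
    split_ifs <;> simp_all
  · rw [if_neg h1, map_zero, map_zero, smul_zero]
    exact Finset.sum_eq_zero fun y _ => if_neg fun hc => h1 hc.2.2

/-! ### The map `ϑ` -/

/-- The linear map `ϑ : P_N → T`, the composition of `‡ : P_N → Fix(G)` and `ε`. -/
noncomputable def varTheta {N : ℕ} (κ : Vertex N) : homPoly N →ₗ[ℂ] subconstituentAlg κ :=
  LinearMap.codRestrict (Subalgebra.toSubmodule (subconstituentAlg κ))
    (epsilonMap κ ∘ₗ (fixSpace N).subtype ∘ₗ ddag N) fun f => by
      refine ddagPoly_mem_of_monomials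
        ((Subalgebra.toSubmodule (subconstituentAlg κ)).comap (epsilonMap κ)) ?_ f.2
      intro r s t u h
      rw [Submodule.mem_comap, epsilonMap_profileVec κ h]
      exact (subconstituentAlg κ).smul_mem (mul_mem (mul_mem
        (dualIdem_mem_subconstituentAlg κ (by omega)) (distMap_mem_subconstituentAlg κ _))
        (dualIdem_mem_subconstituentAlg κ (by omega))) _

/-! ### The two bases of `P_N` -/

/-- The polynomials `x, y, z, w`. -/
noncomputable def polyVar (a : Fin 4) : MvPolynomial (Fin 4) ℂ := MvPolynomial.X a

/-- The polynomials `x*, y*, z*, w*`. -/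
noncomputable def polyDualVar : Fin 4 → MvPolynomial (Fin 4) ℂ :=
  ![(1 / 2 : ℂ) • (polyVar 0 + polyVar 1 + polyVar 2 + polyVar 3), (1 / 2 : ℂ) • (polyVar 0 + polyVar 1 - polyVar 2 - polyVar 3),
    (1 / 2 : ℂ) • (polyVar 0 - polyVar 1 + polyVar 2 - polyVar 3), (1 / 2 : ℂ) • (polyVar 0 - polyVar 1 - polyVar 2 + polyVar 3)]

theorem polyVar_mem (a : Fin 4) : polyVar a ∈ homPoly 1 :=
  MvPolynomial.isHomogeneous_X ℂ a

theorem polyDualVar_mem (a : Fin 4) : polyDualVar a ∈ homPoly 1 := by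
  have h0 := polyVar_mem 0
  have h1 := polyVar_mem 1
  have h2 := polyVar_mem 2
  have h3 := polyVar_mem 3
  fin_cases a <;> refine Submodule.smul_mem _ _ ?_
  · exact add_mem (add_mem (add_mem h0 h1) h2) h3
  · exact sub_mem (sub_mem (add_mem h0 h1) h2) h3
  · exact sub_mem (add_mem (sub_mem h0 h1) h2) h3
  · exact add_mem (sub_mem (sub_mem h0 h1) h2) h3

/-- The product `v_0 ^ r v_1 ^ s v_2 ^ t v_3 ^ u` of linear forms, as an element of `P_N`. -/
noncomputable def linProd {N : ℕ} (v : Fin 4 → MvPolynomial (Fin 4) ℂ)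
    (hv : ∀ a, v a ∈ homPoly 1) (r s t u : ℕ) (h : r + s + t + u = N) : homPoly N :=
  ⟨v 0 ^ r * v 1 ^ s * v 2 ^ t * v 3 ^ u, by
    have H := ((((hv 0).pow r).mul ((hv 1).pow s)).mul ((hv 2).pow t)).mul ((hv 3).pow u)
    rw [MvPolynomial.mem_homogeneousSubmodule]
    convert H using 1
    omega⟩

/-! ### Characters of the cube and the primitive idempotents -/

/-! The formula for monomials is a computation with $B(r,s,t,u)$: `epsilonMap_profileVec` identifies
its image under $\varepsilon$, and the scalars combine to $1/\sqrt{N!}$. The starred formula is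
proved entry by entry. Colour each coordinate $k$ by which member of $(\varkappa_k,y_k,z_k)$, if
any, differs from the other two, and let $m$ be the vector of colour counts. By
`repr_epsilonMap_ddagPoly`, the $(y,z)$-entry of $\vartheta(f)$ is $m!/\sqrt{N!}$ times the
coefficient of $f$ at $m$, where $m!=\prod_a m_a!$. On the other side, expand in the characters
$\chi_S$ of the cube. They are eigenvectors of $\mathsf A$ with eigenvalue $N-2|S|$, and $\mathsf
A^*_h$ is multiplication by $\sum_{|S|=h}\chi_S(\varkappa)\chi_S$. So the $(y,z)$-entry of $\mathsf
E_i\mathsf A^*_h\mathsf E_j$ is $2^{-N}$ times a sum of characters over pairs $(S,T)$ with $|S|$,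
$|T|$, $|S\triangle T|$ prescribed. Such pairs are also 4-colourings of the coordinates, now with
counts $n=(r,s,t,u)$, and the sum becomes the coefficient at $n$ of $L^m$, where $L_a$ are the
linear forms with coefficient rows in `signMatrix`. Since the starred variables are $L_a/2$, what
remains is the reciprocity $m!\,[n\text{-th power}]_m=n!\,[m\text{-th power}]_n$, that is, $m!$
times the coefficient of $L^n$ at $m$ equals $n!$ times that of $L^m$ at $n$. This is
`factorial_mul_coeff_rowForm_symm`; it holds because the matrix is symmetric. -/

/-- The character of the cube attached to a set of coordinates. -/
noncomputable def cubeChar {N : ℕ} (S : Finset (Fin N)) (x : Vertex N) : ℂ :=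
  ∏ k ∈ S, (((x k : ℤˣ) : ℤ) : ℂ)

/-- A character of the cube as a vector of the standard module. -/
noncomputable def charVec {N : ℕ} (S : Finset (Fin N)) : StdModule N :=
  ∑ x, cubeChar S x • vtx N x

theorem int_units_cast_mul_self (a : ℤˣ) : ((a : ℤ) : ℂ) * ((a : ℤ) : ℂ) = 1 := by
  rcases Int.units_eq_one_or a with rfl | rfl <;> simp

theorem repr_charVec {N : ℕ} (S : Finset (Fin N)) (x : Vertex N) :
    (vtx N).repr (charVec S) x = cubeChar S x := by
  rw [charVec, Module.Basis.repr_sum_self]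

theorem cubeChar_flipAt {N : ℕ} (S : Finset (Fin N)) (k : Fin N) (x : Vertex N) :
    cubeChar S (flipAt k x) = (if k ∈ S then -1 else 1) * cubeChar S x := by
  have h1 : ∀ l, ((flipAt k x l : ℤ) : ℂ) = (if k = l then -1 else 1) * ((x l : ℤ) : ℂ) := by
    intro l
    by_cases h : l = k
    · subst h; simp [flipAt]
    · simp [flipAt, h, Ne.symm h]
  simp only [cubeChar, h1, Finset.prod_mul_distrib, Finset.prod_ite_eq]

/-- Expanding $\prod_k(1+x_ky_k)$ over subsets gives the sum; a coordinate where $x$ and $y$ differ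
makes a factor vanish. -/
theorem sum_cubeChar_mul_cubeChar {N : ℕ} (x y : Vertex N) :
    ∑ S, cubeChar S x * cubeChar S y = if x = y then (2 : ℂ) ^ N else 0 := by
  have h : ∑ S, cubeChar S x * cubeChar S y =
      ∏ k, (1 + ((x k : ℤ) : ℂ) * ((y k : ℤ) : ℂ)) := by
    rw [Finset.prod_one_add, Finset.powerset_univ]
    simp only [cubeChar, Finset.prod_mul_distrib]
  rw [h]
  split_ifs with hxy
  · subst hxy
    simp only [int_units_cast_mul_self, Finset.prod_const, Finset.card_univ, Fintype.card_fin]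
    norm_num
  · obtain ⟨k, hk⟩ := Function.ne_iff.mp hxy
    refine Finset.prod_eq_zero (Finset.mem_univ k) ?_
    rw [int_units_eq_neg_of_ne hk]
    have := int_units_cast_mul_self (y k)
    push_cast
    linear_combination -this

theorem cubeChar_mul_cubeChar {N : ℕ} (S T : Finset (Fin N)) (x : Vertex N) :
    cubeChar S x * cubeChar T x = cubeChar (symmDiff S T) x := by
  simp only [cubeChar]
  have hT : ∀ U : Finset (Fin N), ∏ k ∈ U, (((x k : ℤˣ) : ℤ) : ℂ) =
      ∏ k, if k ∈ U then (((x k : ℤˣ) : ℤ) : ℂ) else 1 := fun U => by simp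
  rw [hT S, hT T, hT, ← Finset.prod_mul_distrib]
  refine Finset.prod_congr rfl fun k _ => ?_
  have := int_units_cast_mul_self (x k)
  simp only [Finset.mem_symmDiff]
  by_cases h1 : k ∈ S <;> by_cases h2 : k ∈ T <;> simp [h1, h2, this]

/-- Flipping coordinate $k$ multiplies the character by $-1$ if $k\in S$ and by $1$ otherwise; the
sum of these signs is $N-2|S|$. -/
theorem adjMap_charVec {N : ℕ} (S : Finset (Fin N)) :
    adjMap N (charVec S) = theta N S.card • charVec S := by
  have h1 : adjMap N (charVec S) = ∑ k, ∑ x, cubeChar S (flipAt k x) • vtx N x := by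
    rw [Finset.sum_comm]
    simp only [charVec, map_sum, map_smul, adjMap_vtx_eq_sum_flipAt, Finset.smul_sum]
    rw [Finset.sum_comm]
    nth_rw 2 [Finset.sum_comm]
    refine Finset.sum_congr rfl fun k _ => ?_
    -- For fixed $k$ the flip is an involution, so it moves from the basis vector onto the argument
    -- of the character.
    refine Finset.sum_bij' (fun x _ => flipAt k x) (fun x _ => flipAt k x) ?_ ?_ ?_ ?_ ?_ <;>
      simp [flipAt_flipAt]
  have h2 : ∑ k, (if k ∈ S then (-1 : ℂ) else 1) = theta N S.card := by
    have h3 : ∀ k, (if k ∈ S then (-1 : ℂ) else 1) = 1 - 2 * (if k ∈ S then 1 else 0) := by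
      intro k; split_ifs <;> norm_num
    simp only [h3, Finset.sum_sub_distrib, ← Finset.mul_sum]
    simp [theta]
  rw [h1, ← h2, Finset.sum_smul]
  refine Finset.sum_congr rfl fun k _ => ?_
  simp only [cubeChar_flipAt, charVec, mul_smul, Finset.smul_sum]

theorem adjIdem_charVec {N : ℕ} (i : ℕ) (S : Finset (Fin N)) :
    adjIdem N i (charVec S) = if S.card = i then charVec S else 0 := by
  have hS : charVec S ∈ (adjMap N).eigenspace (theta N S.card) :=
    Module.End.mem_eigenspace_iff.mpr (adjMap_charVec S)
  rw [adjIdem, primitiveIdem]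
  split_ifs with h
  · subst h
    exact Submodule.projection_apply_of_mem_left _ hS
  · rw [Submodule.projection_apply_eq_zero_iff]
    -- `theta N` is injective on all of ℕ, so $i>N$ needs no separate treatment.
    have hne : theta N S.card ≠ theta N i := fun e => h (by simpa [theta] using e)
    exact (le_iSup₂_of_le (f := fun ν (_ : ν ≠ theta N i) => (adjMap N).eigenspace ν)
      _ hne le_rfl) hS

/-- Fourier inversion: it turns knowledge of a map on characters into its matrix entries on
vertices. -/
theorem vtx_eq_sum_charVec {N : ℕ} (x : Vertex N) :
    vtx N x = ((2 : ℂ) ^ N)⁻¹ • ∑ S, cubeChar S x • charVec S := by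
  refine (vtx N).repr.injective (Finsupp.ext fun y => ?_)
  simp only [map_smul, map_sum, Finsupp.smul_apply, Finsupp.coe_finsetSum, Finset.sum_apply,
    repr_charVec, smul_eq_mul, sum_cubeChar_mul_cubeChar, Module.Basis.repr_self,
    Finsupp.single_apply]
  split_ifs <;> simp

theorem adjIdem_vtx {N : ℕ} (i : ℕ) (x : Vertex N) :
    adjIdem N i (vtx N x) =
      ((2 : ℂ) ^ N)⁻¹ • ∑ S with S.card = i, cubeChar S x • charVec S := by
  conv_lhs => rw [vtx_eq_sum_charVec]
  simp only [map_smul, map_sum, adjIdem_charVec, smul_ite, smul_zero, Finset.sum_filter]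

theorem herm_vtx {N : ℕ} (v : StdModule N) (x : Vertex N) :
    herm v (vtx N x) = (vtx N).repr v x := by
  rw [herm]
  conv_lhs => rw [← (vtx N).sum_repr v]
  simp only [inner_sum, inner_smul_right, inner_vtx, mul_ite, mul_one, mul_zero,
    Finset.sum_ite_eq, Finset.mem_univ, if_true]

theorem dualDistMap_vtx {N : ℕ} (κ : Vertex N) (h : ℕ) (x : Vertex N) :
    dualDistMap κ h (vtx N x) = (∑ S with S.card = h, cubeChar S κ * cubeChar S x) • vtx N x := by
  rw [dualDistMap, Module.Basis.constr_basis, herm_vtx, adjIdem_vtx]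
  simp [repr_charVec]

/-- A diagonal map multiplies functions pointwise, and $\chi_S\chi_T=\chi_{S\triangle T}$. -/
theorem dualDistMap_charVec {N : ℕ} (κ : Vertex N) (h : ℕ) (T : Finset (Fin N)) :
    dualDistMap κ h (charVec T) =
      ∑ S with S.card = h, cubeChar S κ • charVec (symmDiff S T) := by
  simp only [charVec, map_sum, map_smul, dualDistMap_vtx, Finset.smul_sum]
  rw [Finset.sum_comm]
  refine Finset.sum_congr rfl fun x _ => ?_
  rw [smul_smul, Finset.mul_sum, Finset.sum_smul]
  refine Finset.sum_congr rfl fun S _ => ?_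
  rw [smul_smul, ← cubeChar_mul_cubeChar]
  ring_nf

/-- $\mathsf E_j$ keeps the $T$ with $|T|=j$ in the expansion of $z$, $\mathsf A^*_h$ shifts $T$ by
each $S$ of size $h$, and $\mathsf E_i$ keeps the results of size $i$. -/
theorem repr_adjIdem_dualDistMap_adjIdem {N : ℕ} (κ : Vertex N) (h i j : ℕ) (y z : Vertex N) :
    (vtx N).repr ((adjIdem N i * dualDistMap κ h * adjIdem N j) (vtx N z)) y =
      ((2 : ℂ) ^ N)⁻¹ * ∑ p : Finset (Fin N) × Finset (Fin N) with
        p.1.card = h ∧ p.2.card = j ∧ (symmDiff p.1 p.2).card = i,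
        cubeChar p.1 κ * cubeChar p.2 z * cubeChar (symmDiff p.1 p.2) y := by
  rw [Module.End.mul_apply, Module.End.mul_apply, adjIdem_vtx]
  simp only [map_smul, map_sum, dualDistMap_charVec, adjIdem_charVec, Finset.smul_sum,
    Finsupp.smul_apply, Finsupp.coe_finsetSum, Finset.sum_apply, smul_eq_mul]
  rw [Finset.mul_sum, Finset.sum_filter, Finset.sum_filter, Fintype.sum_prod_type, Finset.sum_comm]
  refine Finset.sum_congr rfl fun T _ => ?_
  by_cases hT : T.card = j
  · rw [if_pos hT, Finset.sum_filter]
    refine Finset.sum_congr rfl fun S _ => ?_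
    by_cases hS : S.card = h <;> by_cases hU : (symmDiff S T).card = i <;>
      simp [hT, hS, hU, repr_charVec]
    ring
  · simp [hT]
/-! ### Colourings and the coefficients of products of dual variables -/

/-- The number of times each colour is used by a colouring. -/
noncomputable def colorType {ι σ : Type*} [Fintype ι] (φ : ι → σ) : σ →₀ ℕ :=
  ∑ k, Finsupp.single (φ k) 1

theorem colorType_apply {ι σ : Type*} [Fintype ι] [DecidableEq σ] (φ : ι → σ) (a : σ) :
    colorType φ a = Finset.card {k | φ k = a} := by
  simp [colorType, Finsupp.finsetSum_apply, Finsupp.single_apply]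

theorem sum_colorType {ι σ : Type*} [Fintype ι] [Fintype σ] (φ : ι → σ) :
    ∑ a, colorType φ a = Fintype.card ι := by
  classical
  simp only [colorType_apply]
  rw [← Finset.card_univ]
  exact (Finset.card_eq_sum_card_fiberwise fun _ _ => Finset.mem_univ _).symm

theorem prod_pow_colorType {ι σ R : Type*} [Fintype ι] [Fintype σ] [CommMonoid R] (φ : ι → σ)
    (f : σ → R) : ∏ a, f a ^ colorType φ a = ∏ k, f (φ k) := by
  classical
  simp only [colorType_apply]
  rw [← Finset.prod_fiberwise Finset.univ φ]
  refine Finset.prod_congr rfl fun a _ => ?_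
  rw [← Finset.prod_const]
  exact Finset.prod_congr rfl fun k hk => by rw [(Finset.mem_filter.mp hk).2]

/-- The linear forms whose coefficients are the rows of a matrix. -/
noncomputable def rowForm {σ R : Type*} [Fintype σ] [CommSemiring R] (H : Matrix σ σ R) (a : σ) :
    MvPolynomial σ R :=
  ∑ b, MvPolynomial.C (H a b) * MvPolynomial.X b

/-- Arrange the factors along $\iota$ by $\varphi$; expanding the product chooses a variable
$\psi(k)$ at each position $k$. -/
theorem coeff_prod_rowForm {ι σ R : Type*} [Fintype ι] [Fintype σ] [DecidableEq ι]
    [DecidableEq σ] [CommSemiring R] (H : Matrix σ σ R) (φ : ι → σ) (m : σ →₀ ℕ) :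
    (∏ a, rowForm H a ^ colorType φ a).coeff m =
      ∑ ψ : ι → σ with colorType ψ = m, ∏ k, H (φ k) (ψ k) := by
  rw [prod_pow_colorType]
  simp only [rowForm]
  rw [Finset.prod_univ_sum, Fintype.piFinset_univ, MvPolynomial.coeff_sum, Finset.sum_filter]
  refine Finset.sum_congr rfl fun ψ _ => ?_
  have : ∏ k, (MvPolynomial.X (ψ k) : MvPolynomial σ R) =
      MvPolynomial.monomial (colorType ψ) 1 := by
    rw [colorType, MvPolynomial.monomial_sum_one]
    rfl
  rw [Finset.prod_mul_distrib, ← map_prod, this, MvPolynomial.coeff_C_mul,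
    MvPolynomial.coeff_monomial]
  split_ifs <;> simp

/-- Both the count of colourings and the multinomial coefficient are the coefficient at $m$ of
$(\sum_a X_a)^{|\iota|}$. -/
theorem card_colorType {ι σ : Type*} [Fintype ι] [Fintype σ] [DecidableEq ι] [DecidableEq σ]
    (m : σ →₀ ℕ) (hm : ∑ a, m a = Fintype.card ι) :
    Finset.card {φ : ι → σ | colorType φ = m} * ∏ a, (m a).factorial =
      (Fintype.card ι).factorial := by
  have h1 : (∑ a, (MvPolynomial.X a : MvPolynomial σ ℕ)) ^ Fintype.card ι =
      ∏ _k : ι, ∑ a, MvPolynomial.X a := by simp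
  have h2 : ((∑ a, (MvPolynomial.X a : MvPolynomial σ ℕ)) ^ Fintype.card ι).coeff m =
      Finset.card {φ : ι → σ | colorType φ = m} := by
    rw [h1, Finset.prod_univ_sum, Fintype.piFinset_univ, MvPolynomial.coeff_sum,
      Finset.card_filter]
    refine Finset.sum_congr rfl fun ψ _ => ?_
    have : ∏ k, (MvPolynomial.X (ψ k) : MvPolynomial σ ℕ) =
        MvPolynomial.monomial (colorType ψ) 1 := by
      rw [colorType, MvPolynomial.monomial_sum_one]
      rfl
    rw [this, MvPolynomial.coeff_monomial]
  rw [← h2, Finset.sum_pow_eq_sum_piAntidiag, MvPolynomial.coeff_sum, Finset.sum_eq_single ⇑m]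
  · rw [← hm, ← Nat.multinomial_spec, mul_comm]
    congr 1
    have : ∏ a, (MvPolynomial.X a : MvPolynomial σ ℕ) ^ m a = MvPolynomial.monomial m 1 := by
      rw [MvPolynomial.monomial_eq, Finsupp.prod_fintype _ _ (by simp)]; simp
    rw [this, ← map_natCast (MvPolynomial.C (σ := σ) (R := ℕ)), MvPolynomial.coeff_C_mul]
    simp
  · intro k _ hk
    have : ∏ a, (MvPolynomial.X a : MvPolynomial σ ℕ) ^ k a =
        MvPolynomial.monomial (Finsupp.equivFunOnFinite.symm k) 1 := by
      rw [MvPolynomial.monomial_eq, Finsupp.prod_fintype _ _ (by simp)]; simp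
    rw [this, ← map_natCast (MvPolynomial.C (σ := σ) (R := ℕ)), MvPolynomial.coeff_C_mul,
      MvPolynomial.coeff_monomial, if_neg, mul_zero]
    rintro rfl
    exact hk rfl
  · intro h
    simp [hm] at h

/-- Sum $\prod_k H(\varphi(k),\psi(k))$ over all $\varphi$ of type $n$ and $\psi$ of type $m$. Each
$\varphi$ contributes the same coefficient, and exchanging $\varphi$ with $\psi$ is harmless as $H$
is symmetric. The numbers of colourings are $|\iota|!/n!$ and $|\iota|!/m!$. -/
theorem factorial_mul_coeff_rowForm_symm {ι σ : Type*} [Fintype ι] [Fintype σ] [DecidableEq ι]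
    [DecidableEq σ] (H : Matrix σ σ ℂ) (hH : H.IsSymm) (m n : σ →₀ ℕ)
    (hm : ∑ a, m a = Fintype.card ι) (hn : ∑ a, n a = Fintype.card ι) :
    (∏ a, ((m a).factorial : ℂ)) * (∏ a, rowForm H a ^ n a).coeff m =
      (∏ a, ((n a).factorial : ℂ)) * (∏ a, rowForm H a ^ m a).coeff n := by
  have hsum : ∀ m n : σ →₀ ℕ, (Finset.card {φ : ι → σ | colorType φ = n} : ℂ) *
      (∏ a, rowForm H a ^ n a).coeff m =
      ∑ φ : ι → σ with colorType φ = n, ∑ ψ : ι → σ with colorType ψ = m,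
        ∏ k, H (φ k) (ψ k) := by
    intro m n
    rw [← nsmul_eq_mul, ← Finset.sum_const]
    refine Finset.sum_congr rfl fun φ hφ => ?_
    rw [← (Finset.mem_filter.mp hφ).2, coeff_prod_rowForm]
  have hswap : (Finset.card {φ : ι → σ | colorType φ = n} : ℂ) *
      (∏ a, rowForm H a ^ n a).coeff m = (Finset.card {φ : ι → σ | colorType φ = m} : ℂ) *
      (∏ a, rowForm H a ^ m a).coeff n := by
    rw [hsum, hsum, Finset.sum_comm]
    simp only [hH.apply]
  have h1 : (Finset.card {φ : ι → σ | colorType φ = m} : ℂ) * ∏ a, ((m a).factorial : ℂ) =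
      (Fintype.card ι).factorial := by exact_mod_cast card_colorType m hm
  have h2 : (Finset.card {φ : ι → σ | colorType φ = n} : ℂ) * ∏ a, ((n a).factorial : ℂ) =
      (Fintype.card ι).factorial := by exact_mod_cast card_colorType n hn
  have h0 : ((Fintype.card ι).factorial : ℂ) ≠ 0 := Nat.cast_ne_zero.mpr (Nat.factorial_ne_zero _)
  refine mul_left_cancel₀ h0 ?_
  -- The factor $|\iota|!$ is written through colourings of type $n$ on the left and of type $m$ on
  -- the right, to match `hswap`.
  nth_rw 1 [← h2]
  rw [← h1]
  linear_combination (∏ a, ((m a).factorial : ℂ)) * (∏ a, ((n a).factorial : ℂ)) * hswap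
/-! ### Matrix entries of `ϑ` -/

/-- The colour of a triple of signs: which of the three entries differs from the other two,
and `0` if they are all equal. -/
def signColor (a b c : ℤˣ) : Fin 4 :=
  if a = b then (if b = c then 0 else 3) else (if b = c then 1 else 2)

theorem profile_eq_colorType {N : ℕ} (x y z : Vertex N) :
    profile (x, y, z) = (colorType (fun k => signColor (x k) (y k) (z k)) 0,
      colorType (fun k => signColor (x k) (y k) (z k)) 1,
      colorType (fun k => signColor (x k) (y k) (z k)) 2,
      colorType (fun k => signColor (x k) (y k) (z k)) 3) := by
  have h : ∀ a b c : ℤˣ, (signColor a b c = 0 ↔ a = b ∧ b = c) ∧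
      (signColor a b c = 1 ↔ a ≠ b ∧ b = c) ∧ (signColor a b c = 2 ↔ b ≠ c ∧ c = a) ∧
      (signColor a b c = 3 ↔ c ≠ a ∧ a = b) := by decide
  simp only [colorType_apply, profile, h]

/-- Unlike `epsilonMap_profileVec`, this needs no condition on $r+s+t+u$, so it can be tested on
monomials of every degree. -/
theorem repr_epsilonMap_profileVec {N : ℕ} (κ : Vertex N) (r s t u : ℕ) (y z : Vertex N) :
    (vtx N).repr (epsilonMap κ (profileVec N r s t u) (vtx N z)) y =
      ((Real.sqrt (2 ^ N) : ℝ) : ℂ) * if profile (κ, y, z) = (r, s, t, u) then 1 else 0 := by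
  have hε : ∀ p : Vertex N × Vertex N × Vertex N,
      (vtx N).repr (epsilonMap κ (vtx3 N p) (vtx N z)) y =
      if p = (κ, y, z) then ((Real.sqrt (2 ^ N) : ℝ) : ℂ) else 0 := by
    rintro ⟨a, b, c⟩
    rw [epsilonMap, Module.Basis.constr_basis]
    by_cases h1 : a = κ
    · rw [if_pos h1, LinearMap.smul_apply, map_smul, Finsupp.smul_apply, smul_eq_mul, elemMap,
        Module.Basis.constr_basis]
      by_cases h2 : z = c <;> by_cases h3 : b = y <;>
        simp [h1, h2, h3, eq_comm (a := c) (b := z)]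
    · simp [h1]
  rw [profileVec, map_sum, LinearMap.sum_apply, map_sum, Finsupp.coe_finsetSum, Finset.sum_apply]
  simp only [hε, Finset.sum_ite_eq', Finset.mem_filter, Finset.mem_univ, true_and, mul_ite,
    mul_one, mul_zero]

theorem sqrt_factorial_mul_two_pow (N : ℕ) :
    ((Real.sqrt (N.factorial * 2 ^ N) : ℝ) : ℂ) / (N.factorial * 2 ^ N) *
      ((Real.sqrt (2 ^ N) : ℝ) : ℂ) = 1 / ((Real.sqrt N.factorial : ℝ) : ℂ) := by
  have h1 : (0 : ℝ) < N.factorial := Nat.cast_pos.mpr N.factorial_pos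
  have h2 : (0 : ℝ) < 2 ^ N := by positivity
  have key : Real.sqrt (N.factorial * 2 ^ N) / (N.factorial * 2 ^ N) * Real.sqrt (2 ^ N) =
      1 / Real.sqrt N.factorial := by
    rw [Real.sqrt_mul h1.le]
    have e1 := Real.mul_self_sqrt h1.le
    have e2 := Real.mul_self_sqrt h2.le
    have p1 := Real.sqrt_pos.mpr h1
    rw [div_mul_eq_mul_div, div_eq_div_iff (by positivity) p1.ne']
    linear_combination (Real.sqrt (2 ^ N) * Real.sqrt (2 ^ N)) * e1 + (N.factorial : ℝ) * e2
  exact_mod_cast congrArg (fun a : ℝ => (a : ℂ)) key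

/-- The triple $(\varkappa,y,z)$ occurs only in the vector $B$ of its own profile, so the entry sees
a single coefficient of $f$. -/
theorem repr_epsilonMap_ddagPoly {N : ℕ} (κ y z : Vertex N) (f : MvPolynomial (Fin 4) ℂ) :
    (vtx N).repr (epsilonMap κ (ddagPoly N f) (vtx N z)) y =
      1 / ((Real.sqrt N.factorial : ℝ) : ℂ) *
      ((∏ a, ((colorType (fun k => signColor (κ k) (y k) (z k)) a).factorial : ℂ)) *
        f.coeff (colorType fun k => signColor (κ k) (y k) (z k))) := by
  suffices H : Finsupp.lapply y ∘ₗ (vtx N).repr.toLinearMap ∘ₗ LinearMap.applyₗ (vtx N z) ∘ₗ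
      epsilonMap κ ∘ₗ ddagPoly N = (1 / ((Real.sqrt N.factorial : ℝ) : ℂ)) •
      (∏ a, ((colorType (fun k => signColor (κ k) (y k) (z k)) a).factorial : ℂ)) •
        MvPolynomial.lcoeff ℂ (colorType fun k => signColor (κ k) (y k) (z k)) from
    LinearMap.congr_fun H f
  refine (MvPolynomial.basisMonomials (Fin 4) ℂ).ext fun m => ?_
  have hm : profile (κ, y, z) = (m 0, m 1, m 2, m 3) ↔
      m = colorType fun k => signColor (κ k) (y k) (z k) := by
    rw [profile_eq_colorType, Finsupp.ext_iff]
    simp [Fin.forall_fin_succ, eq_comm]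
  have hcoeff : MvPolynomial.lcoeff ℂ (colorType fun k => signColor (κ k) (y k) (z k))
      (MvPolynomial.basisMonomials (Fin 4) ℂ m) =
      if m = colorType fun k => signColor (κ k) (y k) (z k) then 1 else 0 := by
    simp [MvPolynomial.coeff_monomial]
  simp only [LinearMap.comp_apply, LinearMap.smul_apply, hcoeff, ddagPoly,
    Module.Basis.constr_basis, dualProfileVec, map_smul, LinearMap.applyₗ_apply_apply,
    LinearEquiv.coe_coe, Finsupp.lapply_apply, repr_epsilonMap_profileVec, hm, smul_eq_mul]
  split_ifs with h
  · rw [← h, Fin.prod_univ_four, ← sqrt_factorial_mul_two_pow]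
    ring
  · simp

/-! ### Sign triples, pairs of sets and the character table -/

/-- The character table relating the two systems of variables. -/
def signMatrix : Matrix (Fin 4) (Fin 4) ℂ :=
  !![1, 1, 1, 1; 1, 1, -1, -1; 1, -1, 1, -1; 1, -1, -1, 1]

theorem signMatrix_isSymm : signMatrix.IsSymm := by
  ext a b
  fin_cases a <;> fin_cases b <;> rfl

theorem polyDualVar_eq_rowForm (a : Fin 4) :
    polyDualVar a = (1 / 2 : ℂ) • rowForm signMatrix a := by
  fin_cases a <;>
    simp [polyDualVar, rowForm, signMatrix, Fin.sum_univ_four, polyVar, sub_eq_add_neg]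

/-- A colour is a sign triple up to global sign, so the rows list the values of the even characters
$1,bc,ac,ab$. -/
theorem signMatrix_signColor (a b c : ℤˣ) :
    signMatrix (signColor a b c) 0 = 1 ∧
    signMatrix (signColor a b c) 1 = ((b : ℤ) : ℂ) * ((c : ℤ) : ℂ) ∧
    signMatrix (signColor a b c) 2 = ((a : ℤ) : ℂ) * ((c : ℤ) : ℂ) ∧
    signMatrix (signColor a b c) 3 = ((a : ℤ) : ℂ) * ((b : ℤ) : ℂ) := by
  rcases Int.units_eq_one_or a with rfl | rfl <;> rcases Int.units_eq_one_or b with rfl | rfl <;>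
    rcases Int.units_eq_one_or c with rfl | rfl <;> simp [signColor, signMatrix]

/-- The colouring attached to a pair of sets of coordinates. -/
def pairColor {N : ℕ} (p : Finset (Fin N) × Finset (Fin N)) (k : Fin N) : Fin 4 :=
  if k ∈ p.1 then (if k ∈ p.2 then 2 else 3) else (if k ∈ p.2 then 1 else 0)

theorem pairColor_bijective (N : ℕ) :
    Function.Bijective (pairColor : Finset (Fin N) × Finset (Fin N) → Fin N → Fin 4) := by
  refine Function.bijective_iff_has_inverse.mpr
    ⟨fun ψ => (({k | ψ k = 2 ∨ ψ k = 3} : Finset _), ({k | ψ k = 1 ∨ ψ k = 2} : Finset _)), ?_, ?_⟩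
  · rintro ⟨S, T⟩
    refine Prod.ext (Finset.ext fun k => ?_) (Finset.ext fun k => ?_) <;>
      by_cases h1 : k ∈ S <;> by_cases h2 : k ∈ T <;> simp [pairColor, h1, h2]
  · intro ψ
    funext k
    simp only [pairColor, Finset.mem_filter, Finset.mem_univ, true_and]
    generalize ψ k = c
    revert c
    decide

theorem card_pairColor {N : ℕ} (S T : Finset (Fin N)) :
    S.card = colorType (pairColor (S, T)) 2 + colorType (pairColor (S, T)) 3 ∧
    T.card = colorType (pairColor (S, T)) 1 + colorType (pairColor (S, T)) 2 ∧
    (symmDiff S T).card = colorType (pairColor (S, T)) 3 + colorType (pairColor (S, T)) 1 := by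
  simp only [colorType_apply]
  refine ⟨?_, ?_, ?_⟩ <;>
  · rw [← Finset.card_union_of_disjoint
      (Finset.disjoint_filter.mpr fun k _ h1 h2 => by rw [h1] at h2; exact absurd h2 (by decide))]
    congr 1
    ext k
    by_cases h1 : k ∈ S <;> by_cases h2 : k ∈ T <;>
      simp [pairColor, h1, h2, Finset.mem_symmDiff]

/-- Coordinate $k$ contributes $1$, $yz$, $\varkappa z$ or $\varkappa y$ according to its membership
in $S$ and $T$; the colours in `pairColor` are numbered to match the columns of `signMatrix`. -/
theorem cubeChar_pairColor {N : ℕ} (κ y z : Vertex N) (S T : Finset (Fin N)) :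
    cubeChar S κ * cubeChar T z * cubeChar (symmDiff S T) y =
      ∏ k, signMatrix (signColor (κ k) (y k) (z k)) (pairColor (S, T) k) := by
  have hU : ∀ (U : Finset (Fin N)) (x : Vertex N), cubeChar U x =
      ∏ k, if k ∈ U then (((x k : ℤˣ) : ℤ) : ℂ) else 1 := fun U => by simp [cubeChar]
  rw [hU S, hU T, hU, ← Finset.prod_mul_distrib, ← Finset.prod_mul_distrib]
  refine Finset.prod_congr rfl fun k _ => ?_
  obtain ⟨h0, h1, h2, h3⟩ := signMatrix_signColor (κ k) (y k) (z k)
  by_cases hS : k ∈ S <;> by_cases hT : k ∈ T <;>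
    simp [pairColor, hS, hT, h0, h1, h2, h3, Finset.mem_symmDiff, mul_comm]

theorem repr_adjIdem_dualDistMap_adjIdem_eq_coeff {N : ℕ} (κ : Vertex N) (n : Fin 4 →₀ ℕ)
    (hn : n 0 + n 1 + n 2 + n 3 = N) (y z : Vertex N) :
    (vtx N).repr ((adjIdem N (n 3 + n 1) * dualDistMap κ (n 2 + n 3) * adjIdem N (n 1 + n 2))
      (vtx N z)) y = ((2 : ℂ) ^ N)⁻¹ *
      (∏ a, rowForm signMatrix a ^ colorType (fun k => signColor (κ k) (y k) (z k)) a).coeff n := by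
  rw [repr_adjIdem_dualDistMap_adjIdem, coeff_prod_rowForm]
  congr 1
  refine Finset.sum_bijective pairColor (pairColor_bijective N) ?_ ?_
  · rintro ⟨S, T⟩
    obtain ⟨h1, h2, h3⟩ := card_pairColor S T
    -- The three cardinalities determine the counts of colours 1, 2, 3; the total $N$ supplies that
    -- of colour 0.
    have hsum := sum_colorType (pairColor (S, T))
    rw [Fin.sum_univ_four, Fintype.card_fin] at hsum
    simp only [Finset.mem_filter, Finset.mem_univ, true_and, h1, h2, h3, Finsupp.ext_iff,
      Fin.forall_fin_succ]
    simp
    omega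
  · rintro ⟨S, T⟩ _
    exact cubeChar_pairColor κ y z S T

theorem linProd_polyDualVar {N : ℕ} (n : Fin 4 →₀ ℕ) (hn : n 0 + n 1 + n 2 + n 3 = N) :
    (linProd polyDualVar polyDualVar_mem (n 0) (n 1) (n 2) (n 3) hn : MvPolynomial (Fin 4) ℂ) =
      ((2 : ℂ) ^ N)⁻¹ • ∏ a, rowForm signMatrix a ^ n a := by
  have h : ((2 : ℂ) ^ N)⁻¹ =
      (1 / 2) ^ n 0 * (1 / 2) ^ n 1 * (1 / 2) ^ n 2 * (1 / 2) ^ n 3 := by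
    rw [← pow_add, ← pow_add, ← pow_add, hn, one_div, inv_pow]
  simp only [linProd, polyDualVar_eq_rowForm, smul_pow, Fin.prod_univ_four, h,
    smul_mul_smul_comm]

/-! ### The two formulas for `varTheta` -/

theorem coe_varTheta {N : ℕ} (κ : Vertex N) (f : homPoly N) :
    (varTheta κ f : Module.End ℂ (StdModule N)) =
      epsilonMap κ (ddagPoly N (f : MvPolynomial (Fin 4) ℂ)) := rfl

theorem varTheta_linProd_polyDualVar {N : ℕ} (κ : Vertex N) (n : Fin 4 →₀ ℕ)
    (hn : n 0 + n 1 + n 2 + n 3 = N) :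
    (varTheta κ (linProd polyDualVar polyDualVar_mem (n 0) (n 1) (n 2) (n 3) hn) :
        Module.End ℂ (StdModule N)) =
      ((∏ a, ((n a).factorial : ℂ)) / ((Real.sqrt N.factorial : ℝ) : ℂ)) •
        (adjIdem N (n 3 + n 1) * dualDistMap κ (n 2 + n 3) * adjIdem N (n 1 + n 2)) := by
  refine (vtx N).ext fun z => (vtx N).repr.injective (Finsupp.ext fun y => ?_)
  rw [LinearMap.smul_apply, map_smul, Finsupp.smul_apply,
    repr_adjIdem_dualDistMap_adjIdem_eq_coeff κ n hn]
  rw [coe_varTheta, repr_epsilonMap_ddagPoly, linProd_polyDualVar, MvPolynomial.coeff_smul]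
  -- The left entry has the coefficient of $L^n$ at the type of $(\varkappa,y,z)$, the right entry
  -- the coefficient with the two roles exchanged.
  have hsymm := factorial_mul_coeff_rowForm_symm (ι := Fin N) signMatrix signMatrix_isSymm
    (colorType fun k => signColor (κ k) (y k) (z k)) n (sum_colorType _)
    (by rw [Fin.sum_univ_four, Fintype.card_fin, hn])
  simp only [smul_eq_mul]
  linear_combination (1 / ((Real.sqrt N.factorial : ℝ) : ℂ) * ((2 : ℂ) ^ N)⁻¹) * hsymm

theorem varTheta_linProd_polyVar {N : ℕ} (κ : Vertex N) {r s t u : ℕ} (h : r + s + t + u = N) :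
    (varTheta κ (linProd polyVar polyVar_mem r s t u h) : Module.End ℂ (StdModule N)) =
      ((r.factorial * s.factorial * t.factorial * u.factorial : ℂ) /
        ((Real.sqrt N.factorial : ℝ) : ℂ)) •
      (dualIdem κ (s + t) * distMap N (t + u) * dualIdem κ (u + s)) := by
  have hmon : (linProd polyVar polyVar_mem r s t u h : MvPolynomial (Fin 4) ℂ) =
      MvPolynomial.basisMonomials (Fin 4) ℂ (Finsupp.equivFunOnFinite.symm ![r, s, t, u]) := by
    rw [MvPolynomial.coe_basisMonomials]
    beta_reduce
    rw [MvPolynomial.monomial_eq,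
      Finsupp.prod_fintype _ _ (by simp), Fin.prod_univ_four]
    simp [linProd, polyVar]
  rw [coe_varTheta, hmon, ddagPoly, Module.Basis.constr_basis, map_smul, dualProfileVec, map_smul]
  simp only [Finsupp.equivFunOnFinite_symm_apply_apply, Matrix.cons_val]
  rw [epsilonMap_profileVec κ h, smul_smul, smul_smul]
  congr 1
  have := sqrt_factorial_mul_two_pow N
  linear_combination (r.factorial * s.factorial * t.factorial * u.factorial : ℂ) * this

theorem mainTheorem2 (N : ℕ) (κ : Vertex N) (r s t u : ℕ) (hN : r + s + t + u = N)
    (h i j : ℕ) (hh : h = t + u) (hi : i = u + s) (hj : j = s + t) :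
    (varTheta κ (linProd polyVar polyVar_mem r s t u hN) : Module.End ℂ (StdModule N)) =
        ((r.factorial * s.factorial * t.factorial * u.factorial : ℂ) /
          ((Real.sqrt N.factorial : ℝ) : ℂ)) •
        (dualIdem κ j * distMap N h * dualIdem κ i) ∧
      (varTheta κ (linProd polyDualVar polyDualVar_mem r s t u hN) : Module.End ℂ (StdModule N)) =
        ((r.factorial * s.factorial * t.factorial * u.factorial : ℂ) /
          ((Real.sqrt N.factorial : ℝ) : ℂ)) •
        (adjIdem N i * dualDistMap κ h * adjIdem N j) := by
  subst hh hi hj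
  refine ⟨varTheta_linProd_polyVar κ hN, ?_⟩
  have H := varTheta_linProd_polyDualVar κ (Finsupp.equivFunOnFinite.symm ![r, s, t, u]) hN
  rw [Fin.prod_univ_four] at H
  exact H
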